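/- A metric graph $G$ consists of finitely many vertices and finitely many edges, each edge $e$ being a compact interval $[0,|e|]$ of length $0<|e|<\infty$ whose end points are glued to vertices; loops and multiple edges are allowed. Write $V(G)$ for the number of vertices, $L(G)=\sum_e|e|$ for the total length, and $D(G)=\sup\{\operatorname{dist}(x,y):x,y\in G\}$ for the diameter, where $\operatorname{dist}$ is the shortest-path distance and $x,y$ range over all points of $G$, not only over its vertices. Let $H^1(G)$ be the space of functions on $G$ that are $H^1$ on every edge and continuous across the vertices, and let $$\lambda_1(G)=\inf\left\{\frac{\int_G|u'|^2\,dx}{\int_G|u|^2\,dx}\;:\;0\neq u\in H^1(G),\ \int_G u\,dx=0\right\}$$ be the spectral gap, i.e. (for connected $G$) the smallest positive eigenvalue of the Laplacian $-d^2/dx^2$ on $G$ with continuity and Kirchhoff conditions at the vertices. A *pumpkin chain* is a connected metric graph without loops in which exactly two vertices are adjacent to exactly one other vertex, all remaining vertices are adjacent to exactly two other vertices, and any two edges joining the same pair of vertices have the same length. **Lemma.** Let $G$ be a connected (finite, compact) metric graph with at least one edge. Then there is a pumpkin chain $\tilde G$ such that 1. $D(\tilde G)=D(G)$, $L(\tilde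 G)\le L(G)$ and $V(\tilde G)\le V(G)+2$; 2. $\lambda_1(\tilde G)\ge\lambda_1(G)$. Consequently, for every $D>0$, $$\sup\{\lambda_1(G): G \text{ a connected metric graph with at least one edge},\ D(G)=D\}=\sup\{\lambda_1(G): G\text{ a pumpkin chain},\ D(G)=D\}\quad\text{in }[-\infty,\infty].$$ -/

import Mathlib

open MeasureTheory

/-- A finite metric graph: finitely many edges, each a compact interval `[0, len e]` of positive
finite length, whose end points `0` and `len e` are glued to the vertices `src e` and `tgt e`.
Loops and multiple edges are allowed.  (Finiteness of `V` and `E` is imposed by `Fintype`.) -/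
structure MetricGraph (V E : Type*) where
  src : E → V
  tgt : E → V
  len : E → ℝ
  len_pos : ∀ e, 0 < len e

namespace MetricGraph

/-- The points of a metric graph: its vertices and the interior points of its edges. -/
inductive Point {V E : Type*} (G : MetricGraph V E) : Type _
  | vertex (v : V) : Point G
  | inner (e : E) (t : Set.Ioo (0 : ℝ) (G.len e)) : Point G

/-- The parametrisation `[0, len e] → G` of the closed edge `e` by arc length
(extended by constants outside `[0, len e]`). -/
noncomputable def param {V E : Type*} (G : MetricGraph V E) (e : E) (t : ℝ) : G.Point :=
  if h0 : t ≤ 0 then Point.vertex (G.src e)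
  else if h1 : G.len e ≤ t then Point.vertex (G.tgt e)
  else Point.inner e ⟨t, not_le.mp h0, not_le.mp h1⟩

/-- Two vertices are joined by an edge. -/
def Adj {V E : Type*} (G : MetricGraph V E) (v w : V) : Prop :=
  ∃ e, (G.src e = v ∧ G.tgt e = w) ∨ (G.src e = w ∧ G.tgt e = v)

/-- Any two vertices can be joined by a finite walk along edges. -/
def Connected {V E : Type*} (G : MetricGraph V E) : Prop :=
  ∀ v w : V, Relation.ReflTransGen G.Adj v w

/-- The number of vertices. -/
def numVertices {V E : Type*} [Fintype V] (_G : MetricGraph V E) : ℕ := Fintype.card V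

/-- The total length. -/
noncomputable def totalLength {V E : Type*} [Fintype E] (G : MetricGraph V E) : ℝ :=
  ∑ e, G.len e

/-- `G.HasPath x y r`: there is a path in `G` from `x` to `y` of length `r`, made of finitely many
segments, each of them running inside one closed edge. -/
inductive HasPath {V E : Type*} (G : MetricGraph V E) (x : G.Point) : G.Point → ℝ → Prop
  | refl : HasPath G x x 0
  | step {r : ℝ} (e : E) (s t : ℝ) (hs : s ∈ Set.Icc 0 (G.len e)) (ht : t ∈ Set.Icc 0 (G.len e))
      (h : HasPath G x (G.param e s) r) : HasPath G x (G.param e t) (r + |s - t|)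

/-- The distance of two points: the infimum of the lengths of the paths joining them. -/
noncomputable def dist {V E : Type*} (G : MetricGraph V E) (x y : G.Point) : ℝ :=
  sInf {r | G.HasPath x y r}

/-- The diameter: the supremum of the distances of all pairs of points (not only vertices). -/
noncomputable def diam {V E : Type*} (G : MetricGraph V E) : ℝ :=
  sSup {r | ∃ x y : G.Point, r = G.dist x y}

/-- The integral of a function over the graph. -/
noncomputable def integral {V E : Type*} [Fintype E] (G : MetricGraph V E) (u : G.Point → ℝ) : ℝ :=
  ∑ e, ∫ t in (0 : ℝ)..(G.len e), u (G.param e t)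

/-- The Dirichlet integral `∫_G |u'|²`. -/
noncomputable def energy {V E : Type*} [Fintype E] (G : MetricGraph V E) (u : G.Point → ℝ) : ℝ :=
  ∑ e, ∫ t in (0 : ℝ)..(G.len e), (deriv (fun s => u (G.param e s)) t) ^ 2

/-- `u ∈ H¹(G)`: on each closed edge, `u` is absolutely continuous with square integrable
derivative, i.e. the continuous representative of an `H¹` function on the interval.
Since `u` is a function on the points of `G`, it takes one value at each vertex, so that
it is continuous across the vertices. -/
def IsH1 {V E : Type*} (G : MetricGraph V E) (u : G.Point → ℝ) : Prop :=
  ∀ e, AbsolutelyContinuousOnInterval (fun t => u (G.param e t)) 0 (G.len e) ∧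
    MemLp (deriv (fun t => u (G.param e t))) 2 (volume.restrict (Set.Icc 0 (G.len e)))

/-- The spectral gap `λ₁(G)` of the Laplacian with continuity and Kirchhoff vertex conditions:
the infimum of the Rayleigh quotients of all nonzero `u ∈ H¹(G)` of mean zero. -/
noncomputable def spectralGap {V E : Type*} [Fintype E] (G : MetricGraph V E) : ℝ :=
  sInf {r | ∃ u : G.Point → ℝ, G.IsH1 u ∧ G.integral u = 0 ∧
    G.integral (fun x => u x ^ 2) ≠ 0 ∧ r = G.energy u / G.integral (fun x => u x ^ 2)}

/-- The vertices other than `v` that are adjacent to `v`. -/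
def neighbors {V E : Type*} (G : MetricGraph V E) (v : V) : Set V :=
  {w | w ≠ v ∧ G.Adj v w}

/-- Pumpkin chains: connected, without loops, exactly two vertices are adjacent to exactly one
other vertex, all remaining vertices are adjacent to exactly two other vertices, and
any two edges that join the same pair of vertices have the same length. -/
def IsPumpkinChain {V E : Type*} [Fintype V] (G : MetricGraph V E) : Prop :=
  G.Connected ∧
  (∀ e, G.src e ≠ G.tgt e) ∧
  {v | (G.neighbors v).ncard = 2}.ncard + 2 = G.numVertices ∧
  {v | (G.neighbors v).ncard = 1}.ncard = 2 ∧
  ∀ e f, s(G.src e, G.tgt e) = s(G.src f, G.tgt f) → G.len e = G.len f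

end MetricGraph

/-! Choose `x`, `y` realising the diameter `D` and level the graph by the distance from `x`, a
1-Lipschitz function with values in `[0, D]`. The relevant levels are those of the vertices together
with `0` and `D`, so there are at most two more levels than vertices. Identify vertices of equal
level, cut edges so that the levels `0` and `D` are joined, delete loops, shorten every other edge
to the level difference of its ends, and cut edges at the levels they jump over. What remains joins
consecutive levels only, by edges whose length is the level difference: a pumpkin chain. Its
diameter is read off at the end as `D` and need not be followed through the surgery. Only deleting
and shortening change the total length, and they decrease it.

The spectral gap never drops because a test function on the new graph pulls back to the old one,
constant on whatever was removed (`transfers_of_collapse`, `transfers_split`). The energy is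
unchanged and the squared distance to any constant can only grow. Asking for this for all constants
makes the relation transitive and avoids following means; the Rayleigh quotients are compared once,
in `Transfers.spectralGap_le`. The surgery is carried by `Levelled.exists_reach`, `exists_tight` and
`exists_tight_adjacent`. -/

/-- `f` is absolutely continuous on `[a, b]` with square integrable derivative. -/
def SobolevOn (f : ℝ → ℝ) (a b : ℝ) : Prop :=
  AbsolutelyContinuousOnInterval f a b ∧ MemLp (deriv f) 2 (volume.restrict (Set.Icc a b))

/-! ### Concatenation and translation of `H¹` functions on intervals -/

theorem AbsolutelyContinuousOnInterval.congr {f g : ℝ → ℝ} {a b : ℝ}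
    (hf : AbsolutelyContinuousOnInterval f a b) (h : ∀ t ∈ Set.uIcc a b, f t = g t) :
    AbsolutelyContinuousOnInterval g a b := by
  rw [absolutelyContinuousOnInterval_iff] at hf ⊢
  intro ε hε
  obtain ⟨δ, hδ, H⟩ := hf ε hε
  refine ⟨δ, hδ, fun I hI hs => ?_⟩
  have := H I hI hs
  rwa [Finset.sum_congr rfl fun i hi => by rw [h _ (hI.1 i hi).1, h _ (hI.1 i hi).2]] at this

theorem absolutelyContinuousOnInterval_const (c a b : ℝ) :
    AbsolutelyContinuousOnInterval (fun _ => c) a b :=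
  (LipschitzWith.const c).lipschitzOnWith.absolutelyContinuousOnInterval

/-- An absolutely continuous function is the integral of its derivative, and integrability
concatenates; this avoids splitting families of intervals at `b`. -/
theorem AbsolutelyContinuousOnInterval.trans {f : ℝ → ℝ} {a b c : ℝ} (hab : a ≤ b) (hbc : b ≤ c)
    (h₁ : AbsolutelyContinuousOnInterval f a b) (h₂ : AbsolutelyContinuousOnInterval f b c) :
    AbsolutelyContinuousOnInterval f a c := by
  have i₁ := h₁.intervalIntegrable_deriv
  have i₂ := h₂.intervalIntegrable_deriv
  have key := ((i₁.trans i₂).absolutelyContinuousOnInterval_intervalIntegral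
    (c := a) Set.left_mem_uIcc).add (absolutelyContinuousOnInterval_const (f a) a c)
  refine key.congr fun x hx => ?_
  rw [Set.uIcc_of_le (hab.trans hbc)] at hx
  simp only [Pi.add_apply]
  rcases le_total x b with hxb | hxb
  · rw [(h₁.mono (by rw [Set.uIcc_of_le hab, Set.uIcc_of_le hx.1]
                     exact Set.Icc_subset_Icc_right hxb)).integral_deriv_eq_sub]
    ring
  · have h₃ : AbsolutelyContinuousOnInterval f b x :=
      h₂.mono (by rw [Set.uIcc_of_le hbc, Set.uIcc_of_le hxb]
                  exact Set.Icc_subset_Icc_right hx.2)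
    rw [← intervalIntegral.integral_add_adjacent_intervals i₁ h₃.intervalIntegrable_deriv,
      h₁.integral_deriv_eq_sub, h₃.integral_deriv_eq_sub]
    ring

theorem AbsolutelyContinuousOnInterval.comp_sub_right {f : ℝ → ℝ} {a b : ℝ}
    (h : AbsolutelyContinuousOnInterval f a b) (s : ℝ) :
    AbsolutelyContinuousOnInterval (fun t => f (t - s)) (a + s) (b + s) := by
  have i := h.intervalIntegrable_deriv.comp_sub_right s
  have key := (i.absolutelyContinuousOnInterval_intervalIntegral
    (c := a + s) Set.left_mem_uIcc).add
      (absolutelyContinuousOnInterval_const (f a) (a + s) (b + s))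
  refine key.congr fun x hx => ?_
  have hx' : x - s ∈ Set.uIcc a b := by
    rw [Set.mem_uIcc] at hx ⊢
    rcases hx with hx | hx
    · left; constructor <;> linarith
    · right; constructor <;> linarith
  simp only [Pi.add_apply]
  rw [intervalIntegral.integral_comp_sub_right (fun t => deriv f t), add_sub_cancel_right,
    (h.mono (Set.uIcc_subset_uIcc Set.left_mem_uIcc hx')).integral_deriv_eq_sub]
  ring

theorem deriv_eq_of_eqOn_Icc {f g : ℝ → ℝ} {a b : ℝ} (h : ∀ t ∈ Set.Icc a b, f t = g t)
    {t : ℝ} (ht : t ∈ Set.Ioo a b) : deriv f t = deriv g t := by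
  refine Filter.EventuallyEq.deriv_eq ?_
  filter_upwards [isOpen_Ioo.mem_nhds ht] with x hx using h x (Set.Ioo_subset_Icc_self hx)

/-- At the two end points `deriv` also sees values outside the interval, but these points form a
null set. -/
theorem ae_restrict_deriv_eq {f g : ℝ → ℝ} {a b : ℝ} (h : ∀ t ∈ Set.Icc a b, f t = g t) :
    deriv f =ᵐ[volume.restrict (Set.Icc a b)] deriv g := by
  rw [← restrict_Ioo_eq_restrict_Icc]
  exact (ae_restrict_iff' measurableSet_Ioo).2 (.of_forall fun t ht => deriv_eq_of_eqOn_Icc h ht)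

namespace SobolevOn

variable {f g : ℝ → ℝ} {a b c : ℝ}

theorem congr (hf : SobolevOn f a b) (hab : a ≤ b) (h : ∀ t ∈ Set.Icc a b, f t = g t) :
    SobolevOn g a b :=
  ⟨hf.1.congr (by rwa [Set.uIcc_of_le hab]), hf.2.ae_eq (ae_restrict_deriv_eq h)⟩

theorem trans (hab : a ≤ b) (hbc : b ≤ c) (h₁ : SobolevOn f a b) (h₂ : SobolevOn f b c) :
    SobolevOn f a c := by
  refine ⟨h₁.1.trans hab hbc h₂.1, ?_⟩
  rw [memLp_two_iff_integrable_sq (measurable_deriv f).aestronglyMeasurable,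
    ← Set.Icc_union_Icc_eq_Icc hab hbc]
  exact IntegrableOn.union h₁.2.integrable_sq h₂.2.integrable_sq

theorem comp_sub_right (h : SobolevOn f a b) (s : ℝ) :
    SobolevOn (fun t => f (t - s)) (a + s) (b + s) := by
  refine ⟨h.1.comp_sub_right s, ?_⟩
  have e : deriv (fun t => f (t - s)) = deriv f ∘ fun t => t - s := by
    funext t
    exact deriv_comp_sub_const f s t
  rw [e]
  refine h.2.comp_measurePreserving ?_
  have := (measurePreserving_sub_right volume s).restrict_preimage
    (measurableSet_Icc : MeasurableSet (Set.Icc a b))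
  simpa using this

theorem const (c a b : ℝ) : SobolevOn (fun _ => c) a b :=
  ⟨absolutelyContinuousOnInterval_const c a b, by simp⟩

theorem sub_const (hf : SobolevOn f a b) (c : ℝ) : SobolevOn (fun t => f t - c) a b := by
  refine ⟨hf.1.sub (absolutelyContinuousOnInterval_const c a b), ?_⟩
  simpa [deriv_sub_const_fun] using hf.2

theorem of_lipschitzWith {K : NNReal} (hf : LipschitzWith K f) : SobolevOn f a b := by
  refine ⟨hf.lipschitzOnWith.absolutelyContinuousOnInterval, ?_⟩
  exact MemLp.of_bound (measurable_deriv f).aestronglyMeasurable K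
    (.of_forall fun t => norm_deriv_le_of_lipschitz hf)

theorem intervalIntegrable_deriv_sq (hf : SobolevOn f a b) (hab : a ≤ b) :
    IntervalIntegrable (fun t => deriv f t ^ 2) volume a b := by
  rw [intervalIntegrable_iff_integrableOn_Icc_of_le hab]
  exact hf.2.integrable_sq

theorem continuousOn (hf : SobolevOn f a b) (hab : a ≤ b) : ContinuousOn f (Set.Icc a b) := by
  simpa [Set.uIcc_of_le hab] using hf.1.continuousOn

end SobolevOn

theorem integral_deriv_sq_congr {f g : ℝ → ℝ} {a b : ℝ} (hab : a ≤ b)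
    (h : ∀ t ∈ Set.Icc a b, f t = g t) :
    ∫ t in a..b, deriv f t ^ 2 = ∫ t in a..b, deriv g t ^ 2 := by
  rw [intervalIntegral.integral_of_le hab, intervalIntegral.integral_of_le hab,
    ← integral_Icc_eq_integral_Ioc, ← integral_Icc_eq_integral_Ioc]
  refine integral_congr_ae ?_
  filter_upwards [ae_restrict_deriv_eq h] with t ht using by rw [ht]

theorem integral_deriv_sq_comp_sub_right (f : ℝ → ℝ) (a b s : ℝ) :
    ∫ t in (a + s)..(b + s), deriv (fun x => f (x - s)) t ^ 2 = ∫ t in a..b, deriv f t ^ 2 := by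
  simp only [deriv_comp_sub_const]
  rw [intervalIntegral.integral_comp_sub_right (fun t => deriv f t ^ 2)]
  simp

namespace MetricGraph

universe u v u' v'

/-! ### Surgery on graphs and the pull-back of test functions -/

section Transfer

variable {V : Type u} {E : Type v} {V' : Type u'} {E' : Type v'} (G : MetricGraph V E)

theorem param_of_nonpos (e : E) {t : ℝ} (h : t ≤ 0) : G.param e t = .vertex (G.src e) := by
  simp [param, h]

theorem param_of_len_le (e : E) {t : ℝ} (h : G.len e ≤ t) : G.param e t = .vertex (G.tgt e) := by
  have := G.len_pos e
  simp [param, h, not_le.2 (this.trans_le h)]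

theorem param_of_mem_Ioo (e : E) {t : ℝ} (h : t ∈ Set.Ioo 0 (G.len e)) :
    G.param e t = .inner e ⟨t, h⟩ := by
  simp [param, not_le.2 h.1, not_le.2 h.2]

/-- Every `H¹` function on `G'` is matched by an `H¹` function on `G` of no larger energy and no
smaller `L²` distance to each constant. -/
def Transfers [Fintype E] [Fintype E'] (G : MetricGraph V E) (G' : MetricGraph V' E') : Prop :=
  ∀ w : G'.Point → ℝ, G'.IsH1 w → ∃ z : G.Point → ℝ, G.IsH1 z ∧ G.energy z ≤ G'.energy w ∧
    ∀ c : ℝ, G'.integral (fun x => (w x - c) ^ 2) ≤ G.integral (fun x => (z x - c) ^ 2)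

theorem Transfers.refl [Fintype E] (G : MetricGraph V E) : Transfers G G :=
  fun w hw => ⟨w, hw, le_rfl, fun _ => le_rfl⟩

theorem Transfers.trans {V'' E'' : Type*} [Fintype E] [Fintype E'] [Fintype E'']
    {G : MetricGraph V E} {G' : MetricGraph V' E'} {G'' : MetricGraph V'' E''}
    (h : Transfers G G') (h' : Transfers G' G'') : Transfers G G'' := by
  intro w hw
  obtain ⟨z, hz, ez, iz⟩ := h' w hw
  obtain ⟨y, hy, ey, iy⟩ := h z hz
  exact ⟨y, hy, ey.trans ez, fun c => (iz c).trans (iy c)⟩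

/-! ### Gluing vertices, shortening edges and deleting loops -/

/-- The pull-back of `w` is `w` on the retained part of each edge and constant on every removed
piece, so it gains no energy there, while `(z - c) ^ 2` contributes a nonnegative amount. An edge
may be removed entirely only if `ι` closes it up to a loop, as otherwise no constant would match
both ends. Gluing, shortening, deleting loops and relabelling are all instances. -/
theorem transfers_of_collapse [Fintype E] [Fintype E'] {G : MetricGraph V E}
    {G' : MetricGraph V' E'} (ι : V → V') (j : E' → E) (hj : Function.Injective j)
    (hsrc : ∀ e, G'.src e = ι (G.src (j e))) (htgt : ∀ e, G'.tgt e = ι (G.tgt (j e)))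
    (hlen : ∀ e, G'.len e ≤ G.len (j e))
    (hloop : ∀ e, e ∉ Set.range j → ι (G.src e) = ι (G.tgt e)) : Transfers G G' := by
  classical
  intro w hw
  let z : G.Point → ℝ := fun p => match p with
    | .vertex v => w (.vertex (ι v))
    | .inner e t => if h : ∃ e', j e' = e then w (G'.param h.choose t)
        else w (.vertex (ι (G.src e)))
  have z_in : ∀ e t, z (G.param (j e) t) = w (G'.param e t) := by
    intro e t
    by_cases h0 : t ≤ 0
    · rw [param_of_nonpos _ _ h0, param_of_nonpos _ _ h0, hsrc]
    by_cases h1 : G.len (j e) ≤ t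
    · rw [param_of_len_le _ _ h1, param_of_len_le _ _ ((hlen e).trans h1), htgt]
    · rw [param_of_mem_Ioo _ _ ⟨not_le.1 h0, not_le.1 h1⟩]
      have h : ∃ e', j e' = j e := ⟨e, rfl⟩
      simp only [z, dif_pos h, hj h.choose_spec]
  have z_out : ∀ e, e ∉ Set.range j → ∀ t, z (G.param e t) = w (.vertex (ι (G.src e))) := by
    intro e he t
    by_cases h0 : t ≤ 0
    · rw [param_of_nonpos _ _ h0]
    by_cases h1 : G.len e ≤ t
    · rw [param_of_len_le _ _ h1, hloop e he]
    · rw [param_of_mem_Ioo _ _ ⟨not_le.1 h0, not_le.1 h1⟩]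
      exact dif_neg he
  -- Since `param` is constant past the end of an edge, the removed tail carries the value at the
  -- target vertex.
  have tail : ∀ e, ∀ t ∈ Set.Icc (G'.len e) (G.len (j e)),
      w (.vertex (G'.tgt e)) = z (G.param (j e) t) := fun e t ht => by
    rw [z_in, param_of_len_le _ _ ht.1]
  have S₁ : ∀ e, SobolevOn (fun t => z (G.param (j e) t)) 0 (G'.len e) := fun e => by
    simp only [z_in]; exact hw e
  have S₂ : ∀ e, SobolevOn (fun t => z (G.param (j e) t)) (G'.len e) (G.len (j e)) := fun e =>
    (SobolevOn.const (w (.vertex (G'.tgt e))) _ _).congr (hlen e) (tail e)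
  have hz : G.IsH1 z := by
    intro e
    by_cases he : e ∈ Set.range j
    · obtain ⟨e, rfl⟩ := he
      exact (S₁ e).trans (G'.len_pos e).le (hlen e) (S₂ e)
    · simp only [z_out e he]; exact SobolevOn.const _ _ _
  refine ⟨z, hz, ?_, fun c => ?_⟩
  · unfold energy
    rw [← Fintype.sum_of_injective j hj _ _ _ fun e => rfl]
    · refine Finset.sum_le_sum fun e _ => le_of_eq ?_
      rw [← intervalIntegral.integral_add_adjacent_intervals
        ((S₁ e).intervalIntegrable_deriv_sq (G'.len_pos e).le)
        ((S₂ e).intervalIntegrable_deriv_sq (hlen e)),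
        ← integral_deriv_sq_congr (hlen e) (tail e)]
      simp [z_in]
    · intro e he
      simp [z_out e he]
  · unfold integral
    have nonneg : ∀ e a b, a ≤ b → 0 ≤ ∫ t in a..b, (z (G.param e t) - c) ^ 2 := fun e a b h =>
      intervalIntegral.integral_nonneg h fun _ _ => sq_nonneg _
    calc _ ≤ ∑ e, ∫ t in (0 : ℝ)..(G.len (j e)), (z (G.param (j e) t) - c) ^ 2 := ?_
      _ = ∑ e ∈ Finset.univ.image j, ∫ t in (0 : ℝ)..(G.len e), (z (G.param e t) - c) ^ 2 :=
          (Finset.sum_image (f := fun e => ∫ t in (0 : ℝ)..(G.len e), (z (G.param e t) - c) ^ 2)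
            fun _ _ _ _ h => hj h).symm
      _ ≤ _ := Finset.sum_le_sum_of_subset_of_nonneg (Finset.subset_univ _)
          fun e _ _ => nonneg e _ _ (G.len_pos e).le
    refine Finset.sum_le_sum fun e _ => ?_
    have c₁ : ContinuousOn (fun t => (z (G.param (j e) t) - c) ^ 2) (Set.Icc 0 (G'.len e)) :=
      (((S₁ e).sub_const c).continuousOn (G'.len_pos e).le).pow 2
    have c₂ : ContinuousOn (fun t => (z (G.param (j e) t) - c) ^ 2)
        (Set.Icc (G'.len e) (G.len (j e))) :=
      (((S₂ e).sub_const c).continuousOn (hlen e)).pow 2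
    rw [← intervalIntegral.integral_add_adjacent_intervals
      (c₁.intervalIntegrable_of_Icc (G'.len_pos e).le)
      (c₂.intervalIntegrable_of_Icc (hlen e))]
    simp only [z_in]
    have := nonneg (j e) _ _ (hlen e)
    simp only [z_in] at this
    linarith

/-! ### Splitting an edge -/

/-- The edge `e₀` is cut at its point with parameter `s`, and both new ends are glued to the
vertex `w`. -/
noncomputable def split (G : MetricGraph V E) (e₀ : E) (s : ℝ) (hs : s ∈ Set.Ioo 0 (G.len e₀))
    (w : V) : MetricGraph V (Option E) := by
  classical
  exact
  { src := fun e => e.elim w G.src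
    tgt := fun e => e.elim (G.tgt e₀) fun e => if e = e₀ then w else G.tgt e
    len := fun e => e.elim (G.len e₀ - s) fun e => if e = e₀ then s else G.len e
    len_pos := by
      rintro (_ | e)
      · exact sub_pos.2 hs.2
      · simp only [Option.elim]
        split_ifs
        exacts [hs.1, G.len_pos e] }

section Split

variable {G} {e₀ : E} {s : ℝ} {hs : s ∈ Set.Ioo 0 (G.len e₀)} {w : V}

@[simp] theorem split_src_none : (G.split e₀ s hs w).src none = w := rfl
@[simp] theorem split_src_some (e : E) : (G.split e₀ s hs w).src (some e) = G.src e := rfl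
@[simp] theorem split_tgt_none : (G.split e₀ s hs w).tgt none = G.tgt e₀ := rfl
@[simp] theorem split_tgt_self : (G.split e₀ s hs w).tgt (some e₀) = w := by simp [split]
theorem split_tgt_of_ne {e : E} (h : e ≠ e₀) : (G.split e₀ s hs w).tgt (some e) = G.tgt e := by
  simp [split, h]
@[simp] theorem split_len_none : (G.split e₀ s hs w).len none = G.len e₀ - s := rfl
@[simp] theorem split_len_self : (G.split e₀ s hs w).len (some e₀) = s := by simp [split]
theorem split_len_of_ne {e : E} (h : e ≠ e₀) : (G.split e₀ s hs w).len (some e) = G.len e := by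
  simp [split, h]

/-- Serves for lengths, energies, integrals and the count of jumped levels alike. -/
theorem sum_split_eq [Fintype E] {M : Type*} [AddCommMonoid M] {f : Option E → M} {g : E → M}
    (h₀ : f none + f (some e₀) = g e₀) (h : ∀ e, e ≠ e₀ → f (some e) = g e) :
    ∑ e, f e = ∑ e, g e := by
  classical
  rw [Fintype.sum_option, ← Finset.add_sum_erase _ g (Finset.mem_univ e₀),
    ← Finset.add_sum_erase _ (fun e => f (some e)) (Finset.mem_univ e₀), ← add_assoc, h₀]
  congr 1
  exact Finset.sum_congr rfl fun e he => h e (Finset.ne_of_mem_erase he)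

theorem totalLength_split [Fintype E] : (G.split e₀ s hs w).totalLength = G.totalLength :=
  sum_split_eq (by simp) fun _ h => split_len_of_ne h

/-- Undoing the cut only relaxes the continuity conditions: the two halves agree at the cut because
both end in `w`, so they concatenate to an `H¹` function with the same integrals. -/
theorem transfers_split [Fintype E] : Transfers G (G.split e₀ s hs w) := by
  classical
  have src_some : ∀ e, (G.split e₀ s hs w).src (some e) = G.src e := fun _ => rfl
  have src_none : (G.split e₀ s hs w).src none = w := rfl
  have tgt_none : (G.split e₀ s hs w).tgt none = G.tgt e₀ := rfl
  have tgt_self : (G.split e₀ s hs w).tgt (some e₀) = w := split_tgt_self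
  have tgt_ne : ∀ e, e ≠ e₀ → (G.split e₀ s hs w).tgt (some e) = G.tgt e :=
    fun _ => split_tgt_of_ne
  have len_none : (G.split e₀ s hs w).len none = G.len e₀ - s := rfl
  have len_self : (G.split e₀ s hs w).len (some e₀) = s := split_len_self
  have len_ne : ∀ e, e ≠ e₀ → (G.split e₀ s hs w).len (some e) = G.len e :=
    fun _ => split_len_of_ne
  generalize G.split e₀ s hs w = G' at *
  intro f hf
  let z : G.Point → ℝ := fun p => match p with
    | .vertex v => f (.vertex v)
    | .inner e t => if e = e₀ ∧ s ≤ t then f (G'.param none (t - s)) else f (G'.param (some e) t)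
  have z_ne : ∀ e, e ≠ e₀ → ∀ t, z (G.param e t) = f (G'.param (some e) t) := by
    intro e he t
    by_cases h0 : t ≤ 0
    · rw [param_of_nonpos _ _ h0, param_of_nonpos _ _ h0, src_some]
    by_cases h1 : G.len e ≤ t
    · rw [param_of_len_le _ _ h1, param_of_len_le _ _ ((len_ne e he).trans_le h1), tgt_ne e he]
    · rw [param_of_mem_Ioo _ _ ⟨not_le.1 h0, not_le.1 h1⟩]
      simp [z, he]
  have z_le : ∀ t ∈ Set.Icc 0 s, f (G'.param (some e₀) t) = z (G.param e₀ t) := by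
    rintro t ⟨ht0, hts⟩
    rcases ht0.eq_or_lt with rfl | h0
    · rw [param_of_nonpos _ _ le_rfl, param_of_nonpos _ _ le_rfl, src_some]
    rw [G.param_of_mem_Ioo _ ⟨h0, hts.trans_lt hs.2⟩]
    -- At `t = s` the definition of `z` picks the second half; both halves have the value of `f` at
    -- `w` there.
    rcases hts.eq_or_lt with rfl | h1
    · simp only [z, le_refl, and_self, if_true, sub_self]
      rw [param_of_len_le _ _ len_self.le, param_of_nonpos _ _ le_rfl, tgt_self, src_none]
    · simp [z, h1]
  have z_ge : ∀ t ∈ Set.Icc s (G.len e₀), f (G'.param none (t - s)) = z (G.param e₀ t) := by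
    rintro t ⟨hst, ht⟩
    rcases ht.eq_or_lt with rfl | h1
    · rw [G.param_of_len_le _ le_rfl,
        G'.param_of_len_le none len_none.le, tgt_none]
    · rw [G.param_of_mem_Ioo _ ⟨hs.1.trans_le hst, h1⟩]
      simp [z, hst]
  have S₁ : SobolevOn (fun t => f (G'.param (some e₀) t)) 0 s := by
    have := hf (some e₀)
    rwa [len_self] at this
  have S₂ : SobolevOn (fun t => f (G'.param none (t - s))) s (G.len e₀) := by
    have : SobolevOn (fun t => f (G'.param none t)) 0 (G.len e₀ - s) := by
      have := hf none
      rwa [len_none] at this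
    simpa using this.comp_sub_right s
  have T₁ := S₁.congr hs.1.le z_le
  have T₂ := S₂.congr hs.2.le z_ge
  have hz : G.IsH1 z := by
    intro e
    by_cases he : e = e₀
    · subst he
      exact T₁.trans hs.1.le hs.2.le T₂
    · have := hf (some e)
      rw [len_ne e he] at this
      simpa only [z_ne e he] using this
  refine ⟨z, hz, le_of_eq (Eq.symm (sum_split_eq (e₀ := e₀) ?_ ?_)),
    fun c => le_of_eq (sum_split_eq (e₀ := e₀) ?_ ?_)⟩
  · rw [← intervalIntegral.integral_add_adjacent_intervals
      (T₁.intervalIntegrable_deriv_sq hs.1.le) (T₂.intervalIntegrable_deriv_sq hs.2.le),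
      ← integral_deriv_sq_congr hs.1.le z_le, ← integral_deriv_sq_congr hs.2.le z_ge, len_self,
      add_comm]
    congr 1
    rw [len_none]
    have := integral_deriv_sq_comp_sub_right (fun t => f (G'.param none t)) 0 (G.len e₀ - s) s
    rw [zero_add, sub_add_cancel] at this
    exact this.symm
  · intro e he
    simp only [z_ne e he]
    rw [len_ne e he]
  · have c₁ : ContinuousOn (fun t => (z (G.param e₀ t) - c) ^ 2) (Set.Icc 0 s) :=
      ((T₁.sub_const c).continuousOn hs.1.le).pow 2
    have c₂ : ContinuousOn (fun t => (z (G.param e₀ t) - c) ^ 2) (Set.Icc s (G.len e₀)) :=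
      ((T₂.sub_const c).continuousOn hs.2.le).pow 2
    rw [← intervalIntegral.integral_add_adjacent_intervals
      (c₁.intervalIntegrable_of_Icc hs.1.le) (c₂.intervalIntegrable_of_Icc hs.2.le), len_self,
      add_comm]
    congr 1
    · refine intervalIntegral.integral_congr fun t ht => ?_
      rw [Set.uIcc_of_le hs.1.le] at ht
      beta_reduce
      rw [z_le t ht]
    · have := intervalIntegral.integral_comp_sub_right
        (fun t => (f (G'.param none t) - c) ^ 2) s (a := s) (b := G.len e₀)
      rw [sub_self, ← len_none] at this
      refine Eq.trans this.symm (intervalIntegral.integral_congr fun t ht => ?_)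
      rw [Set.uIcc_of_le hs.2.le] at ht
      rw [z_ge t ht]
  · intro e he
    simp only [z_ne e he]
    rw [len_ne e he]

end Split

end Transfer

/-! ### Comparison of spectral gaps -/

section Gap

variable {V E V' E' : Type*}

/-- The tent function, which vanishes at the vertices and measures the distance to the end points
on each edge. -/
noncomputable def tent (G : MetricGraph V E) : G.Point → ℝ
  | .vertex _ => 0
  | .inner e t => min (t : ℝ) (G.len e - t)

theorem tent_param (G : MetricGraph V E) (e : E) (t : ℝ) :
    G.tent (G.param e t) = max 0 (min t (G.len e - t)) := by
  by_cases h0 : t ≤ 0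
  · rw [param_of_nonpos _ _ h0, max_eq_left (min_le_of_left_le h0)]; rfl
  by_cases h1 : G.len e ≤ t
  · rw [param_of_len_le _ _ h1, max_eq_left (min_le_of_right_le (by linarith))]; rfl
  · push Not at h0 h1
    rw [param_of_mem_Ioo _ _ ⟨h0, h1⟩, max_eq_right (le_min h0.le (by linarith))]; rfl

theorem lipschitzWith_tent (G : MetricGraph V E) (e : E) :
    LipschitzWith 1 (fun t => G.tent (G.param e t)) := by
  simp only [tent_param]
  refine LipschitzWith.const_max (LipschitzWith.of_dist_le_mul fun x y => ?_) 0
  simp only [NNReal.coe_one, one_mul, Real.dist_eq]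
  refine (abs_min_sub_min_le_max _ _ _ _).trans (max_le le_rfl ?_)
  rw [show G.len e - x - (G.len e - y) = -(x - y) by ring, abs_neg]

theorem isH1_tent (G : MetricGraph V E) : G.IsH1 G.tent := fun e =>
  SobolevOn.of_lipschitzWith (G.lipschitzWith_tent e)

theorem IsH1.sub_const {G : MetricGraph V E} {w : G.Point → ℝ} (hw : G.IsH1 w) (c : ℝ) :
    G.IsH1 (fun x => w x - c) := fun e => SobolevOn.sub_const (hw e) c

theorem IsH1.continuousOn {G : MetricGraph V E} {w : G.Point → ℝ} (hw : G.IsH1 w) (e : E) :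
    ContinuousOn (fun t => w (G.param e t)) (Set.Icc 0 (G.len e)) :=
  SobolevOn.continuousOn (hw e) (G.len_pos e).le

variable [Fintype E] [Fintype E']

theorem energy_sub_const (G : MetricGraph V E) (w : G.Point → ℝ) (c : ℝ) :
    G.energy (fun x => w x - c) = G.energy w := by
  simp only [energy, deriv_sub_const_fun]

theorem energy_nonneg (G : MetricGraph V E) (w : G.Point → ℝ) : 0 ≤ G.energy w :=
  Finset.sum_nonneg fun e _ =>
    intervalIntegral.integral_nonneg (G.len_pos e).le fun _ _ => sq_nonneg _

theorem integral_sq_nonneg (G : MetricGraph V E) (w : G.Point → ℝ) :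
    0 ≤ G.integral (fun x => w x ^ 2) :=
  Finset.sum_nonneg fun e _ =>
    intervalIntegral.integral_nonneg (G.len_pos e).le fun _ _ => sq_nonneg _

theorem totalLength_pos [Nonempty E] (G : MetricGraph V E) : 0 < G.totalLength :=
  Finset.sum_pos (fun e _ => G.len_pos e) Finset.univ_nonempty

theorem IsH1.integral_sub_const {G : MetricGraph V E} {w : G.Point → ℝ} (hw : G.IsH1 w) (c : ℝ) :
    G.integral (fun x => w x - c) = G.integral w - c * G.totalLength := by
  simp only [integral, totalLength, Finset.mul_sum, ← Finset.sum_sub_distrib]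
  refine Finset.sum_congr rfl fun e _ => ?_
  rw [intervalIntegral.integral_sub
    ((hw.continuousOn e).intervalIntegrable_of_Icc (G.len_pos e).le) intervalIntegrable_const]
  simp [mul_comm]

theorem IsH1.integral_sub_mean [Nonempty E] {G : MetricGraph V E} {w : G.Point → ℝ}
    (hw : G.IsH1 w) : G.integral (fun x => w x - G.integral w / G.totalLength) = 0 := by
  rw [hw.integral_sub_const, div_mul_cancel₀ _ G.totalLength_pos.ne', sub_self]

theorem IsH1.integral_sub_const_sq {G : MetricGraph V E} {w : G.Point → ℝ} (hw : G.IsH1 w)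
    (c : ℝ) : G.integral (fun x => (w x - c) ^ 2) =
      G.integral (fun x => w x ^ 2) - 2 * c * G.integral w + c ^ 2 * G.totalLength := by
  simp only [integral, totalLength, Finset.mul_sum, ← Finset.sum_sub_distrib,
    ← Finset.sum_add_distrib]
  refine Finset.sum_congr rfl fun e _ => ?_
  have i₁ := (hw.continuousOn e).intervalIntegrable_of_Icc (μ := volume) (G.len_pos e).le
  have i₂ : IntervalIntegrable (fun t => w (G.param e t) ^ 2) volume 0 (G.len e) :=
    ((hw.continuousOn e).pow 2).intervalIntegrable_of_Icc (G.len_pos e).le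
  have : ∀ t, (w (G.param e t) - c) ^ 2 =
      (w (G.param e t) ^ 2 - 2 * c * w (G.param e t)) + c ^ 2 := fun t => by ring
  simp only [this]
  rw [intervalIntegral.integral_add (i₂.sub (i₁.const_mul _)) intervalIntegrable_const,
    intervalIntegral.integral_sub i₂ (i₁.const_mul _), intervalIntegral.integral_const_mul]
  simp [mul_comm]

theorem integral_tent_sub_const_sq_pos [Nonempty E] (G : MetricGraph V E) (c : ℝ) :
    0 < G.integral (fun x => (G.tent x - c) ^ 2) := by
  refine Finset.sum_pos (fun e _ => ?_) Finset.univ_nonempty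
  have hl := G.len_pos e
  have hc : ContinuousOn (fun t => (G.tent (G.param e t) - c) ^ 2) (Set.Icc 0 (G.len e)) :=
    (((G.lipschitzWith_tent e).continuous.sub continuous_const).pow 2).continuousOn
  refine intervalIntegral.integral_pos hl hc (fun _ _ => sq_nonneg _) ?_
  by_contra! H
  -- The tent is `0` at an end and `len e / 2` at the midpoint, so it cannot equal `c` at both.
  have h0 := H 0 ⟨le_rfl, hl.le⟩
  have h1 := H (G.len e / 2) ⟨by linarith, by linarith⟩
  have z0 := pow_eq_zero_iff two_ne_zero |>.1 (le_antisymm h0 (sq_nonneg _))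
  have z1 := pow_eq_zero_iff two_ne_zero |>.1 (le_antisymm h1 (sq_nonneg _))
  rw [tent_param] at z0 z1
  rw [show G.len e - G.len e / 2 = G.len e / 2 by ring, min_self, max_eq_right (by linarith)] at z1
  rw [sub_zero, min_eq_left hl.le, max_self] at z0
  linarith

/-- Pull back a mean-zero `w` and subtract the mean `m` of the result. Because `w` has mean zero,
its squared distance to `m` is its squared norm plus `m ^ 2` times the length, so the denominator
does not shrink. The tent minus its mean shows that the infimum on the right is not over the empty
set. -/
theorem Transfers.spectralGap_le [Nonempty E] [Nonempty E'] {G : MetricGraph V E}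
    {G' : MetricGraph V' E'} (h : Transfers G G') : G.spectralGap ≤ G'.spectralGap := by
  refine le_csInf ?_ ?_
  · exact ⟨_, _, G'.isH1_tent.sub_const _, G'.isH1_tent.integral_sub_mean,
      (G'.integral_tent_sub_const_sq_pos _).ne', rfl⟩
  · rintro _ ⟨w, hw, hw0, hw2, rfl⟩
    obtain ⟨z, hz, hE, hI⟩ := h w hw
    set m := G.integral z / G.totalLength with hm
    have hpos : 0 < G'.integral (fun x => w x ^ 2) :=
      lt_of_le_of_ne (G'.integral_sq_nonneg w) hw2.symm
    have hle : G'.integral (fun x => w x ^ 2) ≤ G.integral (fun x => (z x - m) ^ 2) := by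
      refine le_trans ?_ (hI m)
      rw [hw.integral_sub_const_sq, hw0]
      have := mul_nonneg (sq_nonneg m) G'.totalLength_pos.le
      linarith
    have hbdd : BddBelow {r | ∃ u : G.Point → ℝ, G.IsH1 u ∧ G.integral u = 0 ∧
        G.integral (fun x => u x ^ 2) ≠ 0 ∧ r = G.energy u / G.integral (fun x => u x ^ 2)} := by
      refine ⟨0, ?_⟩
      rintro _ ⟨u, -, -, -, rfl⟩
      exact div_nonneg (G.energy_nonneg u) (G.integral_sq_nonneg u)
    refine (csInf_le hbdd ⟨fun x => z x - m, hz.sub_const m, hz.integral_sub_mean,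
      (hpos.trans_le hle).ne', rfl⟩).trans ?_
    rw [energy_sub_const]
    exact div_le_div₀ (G'.energy_nonneg w) hE hpos hle

end Gap

/-! ### Paths, distances and the diameter -/

section Distance

variable {V E : Type*} {G : MetricGraph V E}

theorem HasPath.trans {x y z : G.Point} {r r' : ℝ} (h : G.HasPath x y r) (h' : G.HasPath y z r') :
    G.HasPath x z (r + r') := by
  induction h' with
  | refl => simpa using h
  | step e s t hs ht _ ih => rw [← add_assoc]; exact ih.step e s t hs ht

theorem hasPath_param (e : E) {s t : ℝ} (hs : s ∈ Set.Icc 0 (G.len e))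
    (ht : t ∈ Set.Icc 0 (G.len e)) : G.HasPath (G.param e s) (G.param e t) |s - t| := by
  simpa using (HasPath.refl (x := G.param e s)).step e s t hs ht

theorem HasPath.symm {x y : G.Point} {r : ℝ} (h : G.HasPath x y r) : G.HasPath y x r := by
  induction h with
  | refl => exact .refl
  | step e s t hs ht _ ih =>
    rw [abs_sub_comm, add_comm]
    exact (hasPath_param e ht hs).trans ih

theorem param_zero (e : E) : G.param e 0 = .vertex (G.src e) := G.param_of_nonpos e le_rfl

theorem param_len (e : E) : G.param e (G.len e) = .vertex (G.tgt e) := G.param_of_len_le e le_rfl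

theorem hasPath_edge (e : E) :
    G.HasPath (.vertex (G.src e)) (.vertex (G.tgt e)) (G.len e) := by
  have hl := (G.len_pos e).le
  have := hasPath_param e (s := 0) (t := G.len e) ⟨le_rfl, hl⟩ ⟨hl, le_rfl⟩
  rwa [param_zero, param_len, zero_sub, abs_neg, abs_of_nonneg hl] at this

/-- The source of all lower bounds on distances: it is applied to a constant, to the tent and to the
level function. -/
theorem HasPath.abs_sub_le {f : G.Point → ℝ}
    (hf : ∀ e, ∀ s ∈ Set.Icc 0 (G.len e), ∀ t ∈ Set.Icc 0 (G.len e),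
      |f (G.param e s) - f (G.param e t)| ≤ |s - t|)
    {x y : G.Point} {r : ℝ} (h : G.HasPath x y r) : |f x - f y| ≤ r := by
  induction h with
  | refl => simp
  | step e s t hs ht _ ih => exact (_root_.abs_sub_le _ _ _).trans (add_le_add ih (hf e s hs t ht))

theorem HasPath.nonneg {x y : G.Point} {r : ℝ} (h : G.HasPath x y r) : 0 ≤ r := by
  simpa using h.abs_sub_le (f := fun _ => 0) (by simp)

theorem dist_le_of_hasPath {x y : G.Point} {r : ℝ} (h : G.HasPath x y r) : G.dist x y ≤ r :=
  csInf_le ⟨0, fun _ h => HasPath.nonneg h⟩ h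

theorem dist_nonneg (x y : G.Point) : 0 ≤ G.dist x y := Real.sInf_nonneg fun _ h => h.nonneg

theorem dist_self (x : G.Point) : G.dist x x = 0 :=
  le_antisymm (dist_le_of_hasPath .refl) (dist_nonneg x x)

/-- Connectedness together with the existence of an edge excludes isolated vertices. -/
theorem exists_param_eq [Nonempty E] (hG : G.Connected) (x : G.Point) :
    ∃ e, ∃ t ∈ Set.Icc 0 (G.len e), G.param e t = x := by
  cases x with
  | vertex v =>
    obtain ⟨e₀⟩ := ‹Nonempty E›
    have src : ∀ e, ∃ e', ∃ t ∈ Set.Icc 0 (G.len e'), G.param e' t = .vertex (G.src e) :=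
      fun e => ⟨e, 0, ⟨le_rfl, (G.len_pos e).le⟩, param_zero e⟩
    have tgt : ∀ e, ∃ e', ∃ t ∈ Set.Icc 0 (G.len e'), G.param e' t = .vertex (G.tgt e) :=
      fun e => ⟨e, _, ⟨(G.len_pos e).le, le_rfl⟩, param_len e⟩
    rcases Relation.ReflTransGen.cases_head (hG v (G.src e₀)) with rfl | ⟨w, ⟨e, he⟩, -⟩
    · exact src e₀
    · rcases he with ⟨rfl, -⟩ | ⟨-, rfl⟩
      exacts [src e, tgt e]
  | inner e t => exact ⟨e, t, Set.Ioo_subset_Icc_self t.2, G.param_of_mem_Ioo e t.2⟩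

theorem exists_hasPath [Nonempty E] (hG : G.Connected) (x y : G.Point) : ∃ r, G.HasPath x y r := by
  have vert : ∀ v w, ∃ r, G.HasPath (.vertex v) (.vertex w) r := by
    intro v w
    induction hG v w with
    | refl => exact ⟨0, .refl⟩
    | tail _ h ih =>
      obtain ⟨r, hr⟩ := ih
      obtain ⟨e, ⟨rfl, rfl⟩ | ⟨rfl, rfl⟩⟩ := h
      · exact ⟨_, hr.trans (hasPath_edge e)⟩
      · exact ⟨_, hr.trans (hasPath_edge e).symm⟩
  have toSrc : ∀ x, ∃ v r, G.HasPath x (.vertex v) r := by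
    intro x
    obtain ⟨e, t, ht, rfl⟩ := exists_param_eq hG x
    exact ⟨G.src e, _, param_zero e ▸ hasPath_param e ht ⟨le_rfl, (G.len_pos e).le⟩⟩
  obtain ⟨v, _, hv⟩ := toSrc x
  obtain ⟨w, _, hw⟩ := toSrc y
  obtain ⟨_, hr⟩ := vert v w
  exact ⟨_, (hv.trans hr).trans hw.symm⟩

theorem dist_le_add_of_hasPath [Nonempty E] (hG : G.Connected) {x x' y y' : G.Point} {r r' : ℝ}
    (hx : G.HasPath x x' r) (hy : G.HasPath y y' r') :
    G.dist x y ≤ G.dist x' y' + (r + r') := by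
  rw [← sub_le_iff_le_add]
  refine le_csInf (exists_hasPath hG x' y') fun d hd => ?_
  have := dist_le_of_hasPath ((hx.trans hd).trans hy.symm)
  linarith

theorem abs_dist_param_sub_le [Nonempty E] (hG : G.Connected) {e e' : E} {s s' t t' : ℝ}
    (hs : s ∈ Set.Icc 0 (G.len e)) (hs' : s' ∈ Set.Icc 0 (G.len e))
    (ht : t ∈ Set.Icc 0 (G.len e')) (ht' : t' ∈ Set.Icc 0 (G.len e')) :
    |G.dist (G.param e s) (G.param e' t) - G.dist (G.param e s') (G.param e' t')| ≤
      |s - s'| + |t - t'| := by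
  have h₁ := dist_le_add_of_hasPath hG (hasPath_param e hs hs') (hasPath_param e' ht ht')
  have h₂ := dist_le_add_of_hasPath hG (hasPath_param e hs' hs) (hasPath_param e' ht' ht)
  rw [abs_sub_comm s' s, abs_sub_comm t' t] at h₂
  rw [abs_le]
  constructor <;> linarith

theorem continuousOn_dist_param [Nonempty E] (hG : G.Connected) (e e' : E) :
    ContinuousOn (fun p : ℝ × ℝ => G.dist (G.param e p.1) (G.param e' p.2))
      (Set.Icc 0 (G.len e) ×ˢ Set.Icc 0 (G.len e')) := by
  refine (LipschitzOnWith.of_dist_le_mul (K := 2) fun p hp q hq => ?_).continuousOn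
  refine (abs_dist_param_sub_le hG hp.1 hq.1 hp.2 hq.2).trans ?_
  rw [Prod.dist_eq]
  have h₁ : |p.1 - q.1| ≤ max (Dist.dist p.1 q.1) (Dist.dist p.2 q.2) := le_max_left _ _
  have h₂ : |p.2 - q.2| ≤ max (Dist.dist p.1 q.1) (Dist.dist p.2 q.2) := le_max_right _ _
  push_cast
  linarith

/-- The diameter of a connected compact metric graph is attained. -/
theorem exists_dist_eq_diam [Nonempty E] [Finite E] (hG : G.Connected) :
    ∃ x y, G.dist x y = G.diam ∧ ∀ p q, G.dist p q ≤ G.diam := by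
  -- The pairs of points are covered by finitely many compact rectangles, one for each pair of
  -- edges, on which the distance is continuous.
  have hmax : ∀ k : E × E, ∃ p ∈ Set.Icc 0 (G.len k.1) ×ˢ Set.Icc 0 (G.len k.2),
      IsMaxOn (fun p : ℝ × ℝ => G.dist (G.param k.1 p.1) (G.param k.2 p.2))
        (Set.Icc 0 (G.len k.1) ×ˢ Set.Icc 0 (G.len k.2)) p := fun k =>
    (isCompact_Icc.prod isCompact_Icc).exists_isMaxOn
      ⟨(0, 0), ⟨le_rfl, (G.len_pos _).le⟩, ⟨le_rfl, (G.len_pos _).le⟩⟩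
      (continuousOn_dist_param hG k.1 k.2)
  choose P hP hPmax using hmax
  obtain ⟨k, hk⟩ := Finite.exists_max fun k : E × E =>
    G.dist (G.param k.1 (P k).1) (G.param k.2 (P k).2)
  have ub : ∀ p q, G.dist p q ≤ G.dist (G.param k.1 (P k).1) (G.param k.2 (P k).2) := by
    intro p q
    obtain ⟨e, s, hs, rfl⟩ := exists_param_eq hG p
    obtain ⟨e', t, ht, rfl⟩ := exists_param_eq hG q
    exact (hPmax (e, e') (Set.mk_mem_prod hs ht)).trans (hk (e, e'))
  have hd : G.diam = G.dist (G.param k.1 (P k).1) (G.param k.2 (P k).2) :=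
    IsGreatest.csSup_eq ⟨⟨_, _, rfl⟩, by rintro _ ⟨p, q, rfl⟩; exact ub p q⟩
  exact ⟨_, _, hd.symm, fun p q => (ub p q).trans_eq hd.symm⟩

theorem diam_pos [Nonempty E] [Finite E] (hG : G.Connected) : 0 < G.diam := by
  obtain ⟨-, -, -, hle⟩ := exists_dist_eq_diam hG
  obtain ⟨e⟩ := ‹Nonempty E›
  have hl := G.len_pos e
  refine lt_of_lt_of_le ?_ (hle (G.param e 0) (G.param e (G.len e / 2)))
  refine lt_of_lt_of_le (half_pos hl) (le_csInf (exists_hasPath (E := E) hG _ _) fun r hr => ?_)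
  have := hr.abs_sub_le (f := G.tent) fun e s _ t _ => by
    simpa [Real.dist_eq] using (G.lipschitzWith_tent e).dist_le_mul s t
  rw [tent_param, tent_param, show G.len e - G.len e / 2 = G.len e / 2 by ring, min_self,
    sub_zero, min_eq_left hl.le, max_self, max_eq_right (by linarith), zero_sub, abs_neg,
    abs_of_pos (half_pos hl)] at this
  exact this

end Distance

/-! ### Levelling the graph and cutting it at the levels -/

section Levels

open Relation

theorem Adj.symm {V E : Type*} {G : MetricGraph V E} {v w : V} (h : G.Adj v w) : G.Adj w v := by
  obtain ⟨e, h⟩ := h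
  exact ⟨e, h.symm⟩

variable {V : Type u} {E : Type v} {G : MetricGraph V E}

theorem reflTransGen_symm {v w : V} (h : ReflTransGen G.Adj v w) : ReflTransGen G.Adj w v := by
  induction h with
  | refl => exact .refl
  | tail _ h ih => exact .head h.symm ih

theorem reflTransGen_split {e₀ : E} {s : ℝ} {hs : s ∈ Set.Ioo 0 (G.len e₀)} {x : V} {v w : V}
    (h : ReflTransGen G.Adj v w) : ReflTransGen (G.split e₀ s hs x).Adj v w := by
  have h₁ : (G.split e₀ s hs x).Adj (G.src e₀) x := ⟨some e₀, .inl ⟨rfl, split_tgt_self⟩⟩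
  have h₂ : (G.split e₀ s hs x).Adj x (G.tgt e₀) := ⟨none, .inl ⟨rfl, rfl⟩⟩
  have edge : ∀ e, ReflTransGen (G.split e₀ s hs x).Adj (G.src e) (G.tgt e) ∧
      ReflTransGen (G.split e₀ s hs x).Adj (G.tgt e) (G.src e) := by
    intro e
    by_cases he : e = e₀
    · subst he
      exact ⟨.tail (.single h₁) h₂, .tail (.single h₂.symm) h₁.symm⟩
    · have : (G.split e₀ s hs x).Adj (G.src e) (G.tgt e) :=
        ⟨some e, .inl ⟨rfl, split_tgt_of_ne he⟩⟩
      exact ⟨.single this, .single this.symm⟩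
  induction h with
  | refl => exact .refl
  | tail _ h ih =>
    obtain ⟨e, ⟨rfl, rfl⟩ | ⟨rfl, rfl⟩⟩ := h
    exacts [ih.trans (edge e).1, ih.trans (edge e).2]

/-- `g` is a function on the edges of `G` which is 1-Lipschitz on each edge and takes the value
`a v` at each vertex `v`; all edges can be reached from the vertex `b`. -/
structure Levelled (a : V → ℝ) (G : MetricGraph V E) (g : E → ℝ → ℝ) (b : V) : Prop where
  left : ∀ e, g e 0 = a (G.src e)
  right : ∀ e, g e (G.len e) = a (G.tgt e)
  lip : ∀ e, ∀ s ∈ Set.Icc 0 (G.len e), ∀ t ∈ Set.Icc 0 (G.len e), |g e s - g e t| ≤ |s - t|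
  reach : ∀ e, ReflTransGen G.Adj b (G.src e)

/-- If the level of the vertex `x` is attained on an edge, then `G` can be cut there so that `x`
becomes reachable. -/
theorem Levelled.exists_reach [Fintype E] {a : V → ℝ} (ha : Function.Injective a)
    {g : E → ℝ → ℝ} {b : V} (h : Levelled a G g b) {e₀ : E} {s : ℝ}
    (hs : s ∈ Set.Icc 0 (G.len e₀)) {x : V} (hx : g e₀ s = a x) :
    ∃ (E' : Type v) (_ : Fintype E') (G' : MetricGraph V E') (g' : E' → ℝ → ℝ),
      Levelled a G' g' b ∧ Transfers G G' ∧ G'.totalLength = G.totalLength ∧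
      (∀ v w, ReflTransGen G.Adj v w → ReflTransGen G'.Adj v w) ∧ ReflTransGen G'.Adj b x ∧
      ∀ c, (∃ e, ∃ t ∈ Set.Icc 0 (G.len e), g e t = c) →
        ∃ e, ∃ t ∈ Set.Icc 0 (G'.len e), g' e t = c := by
  classical
  -- A cut needs an interior point. If the level is attained at an end, injectivity of `a` makes `x`
  -- that end, and nothing is to be done.
  rcases hs.1.eq_or_lt with rfl | hs0
  · rw [h.left] at hx
    exact ⟨E, _, G, g, h, .refl G, rfl, fun _ _ h => h, ha hx ▸ h.reach e₀, fun _ h => h⟩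
  rcases hs.2.eq_or_lt with rfl | hs1
  · rw [h.right] at hx
    exact ⟨E, _, G, g, h, .refl G, rfl, fun _ _ h => h,
      ha hx ▸ (h.reach e₀).tail ⟨e₀, .inl ⟨rfl, rfl⟩⟩, fun _ h => h⟩
  have hs' : s ∈ Set.Ioo 0 (G.len e₀) := ⟨hs0, hs1⟩
  have hadj : (G.split e₀ s hs' x).Adj (G.src e₀) x := ⟨some e₀, .inl ⟨rfl, split_tgt_self⟩⟩
  have hbx := (reflTransGen_split (hs := hs') (x := x) (h.reach e₀)).tail hadj
  refine ⟨Option E, inferInstance, G.split e₀ s hs' x,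
    fun e => e.elim (fun t => g e₀ (t + s)) g, ⟨?_, ?_, ?_, ?_⟩, transfers_split,
    totalLength_split, fun _ _ => reflTransGen_split, hbx, ?_⟩
  · rintro (_ | e)
    · simpa using hx
    · exact h.left e
  · rintro (_ | e)
    · simpa using h.right e₀
    · by_cases he : e = e₀
      · subst he; simpa using hx
      · simp only [split_tgt_of_ne he, split_len_of_ne he]; exact h.right e
  · rintro (_ | e) t ⟨ht0, ht1⟩ t' ⟨ht0', ht1'⟩
    · rw [split_len_none] at ht1 ht1'
      simpa using h.lip e₀ (t + s) ⟨by linarith, by linarith⟩ (t' + s) ⟨by linarith, by linarith⟩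
    · by_cases he : e = e₀
      · subst he
        rw [split_len_self] at ht1 ht1'
        exact h.lip e t ⟨ht0, ht1.trans hs.2⟩ t' ⟨ht0', ht1'.trans hs.2⟩
      · rw [split_len_of_ne he] at ht1 ht1'
        exact h.lip e t ⟨ht0, ht1⟩ t' ⟨ht0', ht1'⟩
  · rintro (_ | e)
    · exact hbx
    · exact reflTransGen_split (h.reach e)
  · rintro c ⟨e, t, ⟨ht0, ht1⟩, rfl⟩
    by_cases he : e = e₀
    · subst he
      rcases le_total t s with hts | hst
      · exact ⟨some e, t, ⟨ht0, by rwa [split_len_self]⟩, rfl⟩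
      · exact ⟨none, t - s, ⟨by linarith, by rw [split_len_none]; linarith⟩, by simp⟩
    · exact ⟨some e, t, ⟨ht0, by rwa [split_len_of_ne he]⟩, rfl⟩

/-- Loops are deleted, and all other edges are shortened to the difference of the levels of their
end points. -/
theorem exists_tight [Fintype E] {a : V → ℝ} (ha : Function.Injective a)
    (hlen : ∀ e, |a (G.src e) - a (G.tgt e)| ≤ G.len e) :
    ∃ (E' : Type v) (_ : Fintype E') (G' : MetricGraph V E'),
      (∀ e, G'.len e = |a (G'.src e) - a (G'.tgt e)|) ∧ Transfers G G' ∧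
      G'.totalLength ≤ G.totalLength ∧
      ∀ v w, ReflTransGen G.Adj v w → ReflTransGen G'.Adj v w := by
  classical
  let G' : MetricGraph V {e // G.src e ≠ G.tgt e} :=
    { src := fun e => G.src e
      tgt := fun e => G.tgt e
      len := fun e => |a (G.src e) - a (G.tgt e)|
      -- Distinct vertices have distinct levels, so only loops would shrink to length zero.
      len_pos := fun e => abs_pos.2 (sub_ne_zero.2 (ha.ne e.2)) }
  refine ⟨_, inferInstance, G', fun e => rfl, ?_, ?_, ?_⟩
  · refine transfers_of_collapse id Subtype.val Subtype.val_injective (fun _ => rfl)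
      (fun _ => rfl) (fun e => hlen e) fun e he => ?_
    by_contra hne
    exact he ⟨⟨e, hne⟩, rfl⟩
  · calc G'.totalLength ≤ ∑ e : {e // G.src e ≠ G.tgt e}, G.len e :=
          Finset.sum_le_sum fun e _ => hlen e
      _ = ∑ e ∈ Finset.univ.filter fun e => G.src e ≠ G.tgt e, G.len e :=
          (Finset.sum_subtype _ (by simp) _).symm
      _ ≤ _ := Finset.sum_le_sum_of_subset_of_nonneg (Finset.filter_subset _ _)
          fun e _ _ => (G.len_pos e).le
  · intro v w h
    induction h with
    | refl => exact .refl
    | @tail y z _ h ih =>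
      by_cases hyz : y = z
      · exact hyz ▸ ih
      · obtain ⟨e, h⟩ := h
        refine ih.tail ⟨⟨e, ?_⟩, h⟩
        rcases h with ⟨rfl, rfl⟩ | ⟨rfl, rfl⟩
        exacts [hyz, Ne.symm hyz]

/-- Edges that jump over a level are cut at that level. -/
theorem exists_tight_adjacent {k : ℕ} {a : Fin (k + 1) → ℝ} (ha : StrictMono a) (N : ℕ) :
    ∀ {E : Type v} [Fintype E] (G : MetricGraph (Fin (k + 1)) E),
      (∀ e, G.len e = |a (G.src e) - a (G.tgt e)|) →
      ∑ e, (Nat.dist (G.src e) (G.tgt e) - 1) = N →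
    ∃ (E' : Type v) (_ : Fintype E') (G' : MetricGraph (Fin (k + 1)) E'),
      (∀ e, G'.len e = |a (G'.src e) - a (G'.tgt e)|) ∧
      (∀ e, Nat.dist (G'.src e) (G'.tgt e) = 1) ∧ Transfers G G' ∧
      G'.totalLength = G.totalLength ∧
      ∀ v w, ReflTransGen G.Adj v w → ReflTransGen G'.Adj v w := by
  classical
  induction N using Nat.strong_induction_on with
  | _ N IH =>
  intro E _ G hlen hN
  have hne : ∀ e, (G.src e : ℕ) ≠ G.tgt e := fun e h => by
    have := G.len_pos e
    rw [hlen, Fin.ext h] at this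
    simp at this
  by_cases hjump : ∀ e, Nat.dist (G.src e) (G.tgt e) = 1
  · exact ⟨E, _, G, hlen, hjump, .refl G, rfl, fun _ _ h => h⟩
  push Not at hjump
  obtain ⟨e₀, he₀⟩ := hjump
  have hne₀ := hne e₀
  have hlt := (G.src e₀).2
  have hlt' := (G.tgt e₀).2
  obtain ⟨x, hx⟩ : ∃ x : Fin (k + 1), ((G.src e₀ : ℕ) < x ∧ (x : ℕ) < G.tgt e₀) ∨
      ((G.tgt e₀ : ℕ) < x ∧ (x : ℕ) < G.src e₀) := by
    -- The level just above the lower end lies strictly between the ends, as the edge jumps by at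
    -- least two.
    refine ⟨⟨min (G.src e₀ : ℕ) (G.tgt e₀) + 1, ?_⟩, ?_⟩ <;> simp only [Nat.dist] at * <;> omega
  have hbetw : 0 < |a (G.src e₀) - a x| ∧ 0 < |a x - a (G.tgt e₀)| ∧
      |a (G.src e₀) - a x| + |a x - a (G.tgt e₀)| = G.len e₀ := by
    rw [hlen]
    rcases hx with ⟨h₁, h₂⟩ | ⟨h₁, h₂⟩
    · have h₁ := ha (Fin.lt_def.2 h₁)
      have h₂ := ha (Fin.lt_def.2 h₂)
      rw [abs_of_neg (by linarith), abs_of_neg (by linarith), abs_of_neg (by linarith)]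
      refine ⟨?_, ?_, ?_⟩ <;> linarith
    · have h₁ := ha (Fin.lt_def.2 h₁)
      have h₂ := ha (Fin.lt_def.2 h₂)
      rw [abs_of_pos (by linarith), abs_of_pos (by linarith), abs_of_pos (by linarith)]
      refine ⟨?_, ?_, ?_⟩ <;> linarith
  obtain ⟨hb₁, hb₂, hb₃⟩ := hbetw
  have hs : |a (G.src e₀) - a x| ∈ Set.Ioo 0 (G.len e₀) := ⟨hb₁, by linarith⟩
  -- An edge of jump `p + q` contributes `p + q - 1`; its two pieces contribute `(p - 1) + (q - 1)`,
  -- one less.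
  have hdecr : ∑ e, (Nat.dist ((G.split e₀ _ hs x).src e) ((G.split e₀ _ hs x).tgt e) - 1) < N := by
    rw [← hN, sum_split_eq (e₀ := e₀) (g := Function.update
        (fun e => Nat.dist (G.src e) (G.tgt e) - 1) e₀
        ((Nat.dist x (G.tgt e₀) - 1) + (Nat.dist (G.src e₀) x - 1)))
      (by simp) fun e he => by simp [he, split_tgt_of_ne he]]
    refine Finset.sum_lt_sum (fun e _ => ?_) ⟨e₀, Finset.mem_univ _, ?_⟩
    · by_cases he : e = e₀
      · subst he
        simp only [Function.update_self, Nat.dist] at *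
        omega
      · simp [he]
    · simp only [Function.update_self, Nat.dist] at *
      omega
  have htight : ∀ e, (G.split e₀ _ hs x).len e =
      |a ((G.split e₀ _ hs x).src e) - a ((G.split e₀ _ hs x).tgt e)| := by
    rintro (_ | e)
    · simp only [split_len_none, split_src_none, split_tgt_none]
      linarith
    · by_cases he : e = e₀
      · subst he
        simp
      · rw [split_len_of_ne he, split_tgt_of_ne he, split_src_some, hlen]
  obtain ⟨E', _, G', h₁, h₂, h₃, h₄, h₅⟩ := IH _ hdecr (G.split e₀ _ hs x) htight rfl
  exact ⟨E', _, G', h₁, h₂, transfers_split.trans h₃, h₄.trans totalLength_split,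
    fun v w h => h₅ v w (reflTransGen_split h)⟩

/-- A discrete intermediate value argument: a walk with unit steps from `0` to beyond `i` must at
some moment step from `i` to `i + 1`. -/
theorem adj_of_reflTransGen {k : ℕ} {G : MetricGraph (Fin (k + 1)) E}
    (hG : ∀ e, Nat.dist (G.src e) (G.tgt e) = 1) (i : Fin k) {y : Fin (k + 1)}
    (h : ReflTransGen G.Adj 0 y) : (i : ℕ) < y → G.Adj i.castSucc i.succ := by
  induction h with
  | refl => simp
  | @tail y z _ h ih =>
    intro hz
    by_cases hy : (i : ℕ) < y
    · exact ih hy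
    · have : Nat.dist y z = 1 := by
        obtain ⟨e, ⟨rfl, rfl⟩ | ⟨rfl, rfl⟩⟩ := h
        exacts [hG e, Nat.dist_comm _ _ ▸ hG e]
      simp only [Nat.dist] at this
      have hy' : y = i.castSucc := Fin.ext (by simp; omega)
      have hz' : z = i.succ := Fin.ext (by simp; omega)
      rwa [hy', hz'] at h

end Levels

/-! ### Chains of levels: pumpkin structure and diameter -/

section Chain

open Relation

variable {E : Type*} {k : ℕ} {a : Fin (k + 1) → ℝ} {G : MetricGraph (Fin (k + 1)) E}

theorem neighbors_eq_of_chain (hdist : ∀ e, Nat.dist (G.src e) (G.tgt e) = 1)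
    (hgap : ∀ i : Fin k, G.Adj i.castSucc i.succ) (i : Fin (k + 1)) :
    G.neighbors i = {j : Fin (k + 1) | Nat.dist i j = 1} := by
  ext j
  constructor
  · rintro ⟨-, e, ⟨rfl, rfl⟩ | ⟨rfl, rfl⟩⟩
    exacts [hdist e, (Nat.dist_comm _ _).trans (hdist e)]
  · intro h
    have hi := i.2
    have hj := j.2
    simp only [Set.mem_ofPred_eq, Nat.dist] at h
    refine ⟨fun h' => by subst h'; omega, ?_⟩
    rcases lt_or_ge (i : ℕ) j with hij | hij
    · have h₂ : j = (⟨i, by omega⟩ : Fin k).succ := Fin.ext (by simp; omega)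
      rw [h₂]; exact hgap ⟨i, by omega⟩
    · have h₂ : i = (⟨j, by omega⟩ : Fin k).succ := Fin.ext (by simp; omega)
      rw [h₂]; exact (hgap ⟨j, by omega⟩).symm

theorem ncard_dist_eq_one (hk : 0 < k) (i : Fin (k + 1)) :
    {j : Fin (k + 1) | Nat.dist i j = 1}.ncard = if i = 0 ∨ i = Fin.last k then 1 else 2 := by
  have hi := i.2
  split_ifs with h
  · rw [Set.ncard_eq_one]
    rcases h with rfl | rfl
    · refine ⟨⟨1, by omega⟩, Set.ext fun j => ?_⟩
      simp only [Set.mem_ofPred_eq, Nat.dist, Set.mem_singleton_iff, Fin.ext_iff, Fin.val_zero]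
      omega
    · refine ⟨⟨k - 1, by omega⟩, Set.ext fun j => ?_⟩
      have := j.2
      simp only [Set.mem_ofPred_eq, Nat.dist, Set.mem_singleton_iff, Fin.ext_iff, Fin.val_last]
      omega
  · simp only [Fin.ext_iff, Fin.val_zero, Fin.val_last] at h
    rw [Set.ncard_eq_two]
    refine ⟨⟨i - 1, by omega⟩, ⟨i + 1, by omega⟩, ?_, Set.ext fun j => ?_⟩
    · simp only [ne_eq, Fin.ext_iff]; omega
    · simp only [Set.mem_ofPred_eq, Nat.dist, Set.mem_insert_iff, Set.mem_singleton_iff,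
        Fin.ext_iff]
      omega

theorem isPumpkinChain_of_chain (hk : 0 < k)
    (hlen : ∀ e, G.len e = |a (G.src e) - a (G.tgt e)|)
    (hdist : ∀ e, Nat.dist (G.src e) (G.tgt e) = 1)
    (hgap : ∀ i : Fin k, G.Adj i.castSucc i.succ) : G.IsPumpkinChain := by
  have hcard : ∀ i, (G.neighbors i).ncard = if i = 0 ∨ i = Fin.last k then 1 else 2 := fun i => by
    rw [neighbors_eq_of_chain hdist hgap, ncard_dist_eq_one hk]
  have hends : {v | (G.neighbors v).ncard = 1} = {0, Fin.last k} := by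
    ext v
    simp only [Set.mem_ofPred_eq, hcard, Set.mem_insert_iff, Set.mem_singleton_iff]
    split_ifs with h <;> simp [h]
  have hmid : {v | (G.neighbors v).ncard = 2} = {0, Fin.last k}ᶜ := by
    ext v
    simp only [Set.mem_ofPred_eq, hcard, Set.mem_compl_iff, Set.mem_insert_iff,
      Set.mem_singleton_iff]
    split_ifs with h <;> simp [h]
  have hpair : ({0, Fin.last k} : Set (Fin (k + 1))).ncard = 2 :=
    Set.ncard_pair fun h => by simp [Fin.ext_iff] at h; omega
  refine ⟨?_, ?_, ?_, ?_, ?_⟩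
  · have h0 : ∀ i, ReflTransGen G.Adj 0 i ∧ ReflTransGen G.Adj i 0 := by
      intro i
      induction i using Fin.induction with
      | zero => exact ⟨.refl, .refl⟩
      | succ i ih => exact ⟨ih.1.tail (hgap i), .head (hgap i).symm ih.2⟩
    exact fun v w => (h0 v).2.trans (h0 w).1
  · intro e h
    have := hdist e
    rw [h, Nat.dist_self] at this
    omega
  · rw [hmid]
    have := Set.ncard_add_ncard_compl ({0, Fin.last k} : Set (Fin (k + 1)))
    rw [hpair, Nat.card_eq_fintype_card] at this
    rw [numVertices]
    omega
  · rw [hends, hpair]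
  · intro e f h
    rw [hlen, hlen]
    rcases Sym2.eq_iff.1 h with ⟨h₁, h₂⟩ | ⟨h₁, h₂⟩
    · rw [h₁, h₂]
    · rw [h₁, h₂, abs_sub_comm]

/-- The level of a point of a chain, interpolated linearly on the edges. -/
noncomputable def level (a : Fin (k + 1) → ℝ) (G : MetricGraph (Fin (k + 1)) E) : G.Point → ℝ
  | .vertex v => a v
  | .inner e t => a (G.src e) + t / G.len e * (a (G.tgt e) - a (G.src e))

theorem level_param {e : E} {t : ℝ} (ht : t ∈ Set.Icc 0 (G.len e)) :
    level a G (G.param e t) = a (G.src e) + t / G.len e * (a (G.tgt e) - a (G.src e)) := by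
  have := G.len_pos e
  rcases ht.1.eq_or_lt with rfl | h0
  · rw [param_zero]; simp [level]
  rcases ht.2.eq_or_lt with rfl | h1
  · rw [param_len, div_self this.ne']; simp [level]
  · rw [G.param_of_mem_Ioo e ⟨h0, h1⟩]; rfl

theorem abs_level_sub_le (hlen : ∀ e, G.len e = |a (G.src e) - a (G.tgt e)|) (e : E) (s : ℝ)
    (hs : s ∈ Set.Icc 0 (G.len e)) (t : ℝ) (ht : t ∈ Set.Icc 0 (G.len e)) :
    |level a G (G.param e s) - level a G (G.param e t)| ≤ |s - t| := by
  have hl := G.len_pos e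
  rw [level_param hs, level_param ht,
    show ∀ p q : ℝ, p + s / G.len e * q - (p + t / G.len e * q) = (s - t) * (q / G.len e) by
      intro p q; field_simp; ring, abs_mul, abs_div, abs_sub_comm (a (G.tgt e)), ← hlen,
    abs_of_pos hl, div_self hl.ne', mul_one]

theorem hasPath_gap (ha : StrictMono a)
    (hlen : ∀ e, G.len e = |a (G.src e) - a (G.tgt e)|)
    (hgap : ∀ i : Fin k, G.Adj i.castSucc i.succ) (i : Fin k) :
    G.HasPath (.vertex i.castSucc) (.vertex i.succ) (a i.succ - a i.castSucc) := by
  have hi := ha (Fin.castSucc_lt_succ (i := i))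
  obtain ⟨e, ⟨h₁, h₂⟩ | ⟨h₁, h₂⟩⟩ := hgap i
  · have := hasPath_edge (G := G) e
    rwa [hlen, h₁, h₂, abs_sub_comm, abs_of_pos (sub_pos.2 hi)] at this
  · have := (hasPath_edge (G := G) e).symm
    rwa [hlen, h₁, h₂, abs_of_pos (sub_pos.2 hi)] at this

theorem hasPath_vertex_ends (ha : StrictMono a)
    (hlen : ∀ e, G.len e = |a (G.src e) - a (G.tgt e)|)
    (hgap : ∀ i : Fin k, G.Adj i.castSucc i.succ) (v : Fin (k + 1)) :
    G.HasPath (.vertex v) (.vertex 0) (a v - a 0) ∧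
      G.HasPath (.vertex v) (.vertex (Fin.last k)) (a (Fin.last k) - a v) := by
  constructor
  · induction v using Fin.induction with
    | zero => rw [sub_self]; exact .refl
    | succ i ih =>
      have := (hasPath_gap ha hlen hgap i).symm.trans ih
      rwa [sub_add_sub_cancel] at this
  · induction v using Fin.reverseInduction with
    | last => rw [sub_self]; exact .refl
    | cast i ih =>
      have := (hasPath_gap ha hlen hgap i).trans ih
      rwa [sub_add_sub_cancel'] at this

/-- Here `L` is the level of `p`: from any point one can run monotonically to either end of the
chain. -/
theorem exists_hasPath_ends (ha : StrictMono a)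
    (hlen : ∀ e, G.len e = |a (G.src e) - a (G.tgt e)|)
    (hgap : ∀ i : Fin k, G.Adj i.castSucc i.succ) (p : G.Point) :
    ∃ L, G.HasPath p (.vertex 0) (L - a 0) ∧
      G.HasPath p (.vertex (Fin.last k)) (a (Fin.last k) - L) := by
  cases p with
  | vertex v => exact ⟨a v, hasPath_vertex_ends ha hlen hgap v⟩
  | inner e t =>
    have hl := hlen e
    have hpos := G.len_pos e
    obtain ⟨t, ht⟩ := t
    rw [← G.param_of_mem_Ioo e ht]
    have ht' := Set.Ioo_subset_Icc_self ht
    have h₀ := hasPath_param e ht' ⟨le_rfl, hpos.le⟩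
    have h₁ := hasPath_param e ht' ⟨hpos.le, le_rfl⟩
    rw [param_zero, sub_zero, abs_of_pos ht.1] at h₀
    rw [param_len, abs_sub_comm, abs_of_pos (sub_pos.2 ht.2)] at h₁
    obtain ⟨s₀, s₁⟩ := hasPath_vertex_ends ha hlen hgap (G.src e)
    obtain ⟨t₀, t₁⟩ := hasPath_vertex_ends ha hlen hgap (G.tgt e)
    rcases le_total (a (G.src e)) (a (G.tgt e)) with h | h
    · rw [abs_sub_comm, abs_of_nonneg (sub_nonneg.2 h)] at hl
      refine ⟨a (G.src e) + t, ?_, ?_⟩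
      · convert h₀.trans s₀ using 1; ring
      · convert h₁.trans t₁ using 1; rw [hl]; ring
    · rw [abs_of_nonneg (sub_nonneg.2 h)] at hl
      refine ⟨a (G.src e) - t, ?_, ?_⟩
      · convert h₁.trans t₀ using 1; rw [hl]; ring
      · convert h₀.trans s₁ using 1; ring

/-- The level is 1-Lipschitz, which bounds the distance of the two ends from below. For the upper
bound, join two points once through each end of the chain: the two routes together have length `2 *
(a (Fin.last k) - a 0)`, so the shorter one is at most half of that. -/
theorem diam_of_chain (ha : StrictMono a)
    (hlen : ∀ e, G.len e = |a (G.src e) - a (G.tgt e)|)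
    (hgap : ∀ i : Fin k, G.Adj i.castSucc i.succ) : G.diam = a (Fin.last k) - a 0 := by
  refine IsGreatest.csSup_eq ⟨⟨.vertex 0, .vertex (Fin.last k), ?_⟩, ?_⟩
  · have hpath := (hasPath_vertex_ends ha hlen hgap 0).2
    refine le_antisymm (le_csInf ⟨_, hpath⟩ fun r hr => ?_) (dist_le_of_hasPath hpath)
    have := hr.abs_sub_le (abs_level_sub_le hlen)
    rw [abs_sub_comm] at this
    exact (le_abs_self _).trans this
  · rintro _ ⟨p, q, rfl⟩
    obtain ⟨L, hp₀, hp₁⟩ := exists_hasPath_ends ha hlen hgap p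
    obtain ⟨M, hq₀, hq₁⟩ := exists_hasPath_ends ha hlen hgap q
    have h₀ := dist_le_of_hasPath (hp₀.trans hq₀.symm)
    have h₁ := dist_le_of_hasPath (hp₁.trans hq₁.symm)
    linarith

end Chain

/-! ### Assembly of the pumpkin chain -/

open Relation in
theorem exists_pumpkinChain {V : Type u} {E : Type v} [Fintype V] [Fintype E] [Nonempty E]
    (G : MetricGraph V E) (hG : G.Connected) :
    ∃ (n m : ℕ) (H : MetricGraph (Fin n) (Fin m)), H.IsPumpkinChain ∧
      H.diam = G.diam ∧ H.totalLength ≤ G.totalLength ∧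
      H.numVertices ≤ G.numVertices + 2 ∧ G.spectralGap ≤ H.spectralGap := by
  classical
  obtain ⟨x, y, hxy, hmax⟩ := exists_dist_eq_diam hG
  have hD := diam_pos hG
  set D := G.diam
  -- `0` and `D` are added because `x` and `y` may be interior to edges; this is the source of the
  -- `+ 2`.
  let A : Finset ℝ := Finset.univ.image (fun v => G.dist x (.vertex v)) ∪ {0, D}
  have hA : A.card ≤ Fintype.card V + 2 :=
    (Finset.card_union_le _ _).trans (add_le_add Finset.card_image_le Finset.card_le_two)
  have h0A : 0 ∈ A := by simp [A]
  have hDA : D ∈ A := by simp [A]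
  have hAI : ∀ c ∈ A, 0 ≤ c ∧ c ≤ D := by
    intro c hc
    simp only [A, Finset.mem_union, Finset.mem_image, Finset.mem_univ, true_and,
      Finset.mem_insert, Finset.mem_singleton] at hc
    rcases hc with ⟨v, rfl⟩ | rfl | rfl
    exacts [⟨dist_nonneg _ _, hmax _ _⟩, ⟨le_rfl, hD.le⟩, ⟨hD.le, le_rfl⟩]
  obtain ⟨k, hk⟩ : ∃ k, A.card = k + 1 :=
    Nat.exists_eq_succ_of_ne_zero (Finset.card_ne_zero_of_mem h0A)
  let a : Fin (k + 1) → ℝ := A.orderEmbOfFin hk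
  have ha : StrictMono a := (A.orderEmbOfFin hk).strictMono
  have haA : ∀ i, a i ∈ A := A.orderEmbOfFin_mem hk
  have hasurj : ∀ c ∈ A, ∃ i, a i = c := fun c hc => by
    have : c ∈ Set.range (A.orderEmbOfFin hk) := by rwa [Finset.range_orderEmbOfFin]
    exact this
  have ha0 : a 0 = 0 := by
    obtain ⟨i, hi⟩ := hasurj 0 h0A
    exact le_antisymm (hi ▸ ha.monotone (Fin.zero_le i)) (hAI _ (haA 0)).1
  have haD : a (Fin.last k) = D := by
    obtain ⟨i, hi⟩ := hasurj D hDA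
    exact le_antisymm (hAI _ (haA _)).2 (hi ▸ ha.monotone (Fin.le_last i))
  have hkpos : 0 < k := by
    rcases Nat.eq_zero_or_pos k with rfl | h
    · have : a 0 = D := haD
      rw [ha0] at this
      exact absurd this hD.ne
    · exact h
  choose ι hι using fun v => hasurj (G.dist x (.vertex v)) (by simp [A])
  -- glue the vertices of equal level
  let G₁ : MetricGraph (Fin (k + 1)) E := ⟨fun e => ι (G.src e), fun e => ι (G.tgt e), G.len,
    G.len_pos⟩
  have t₁ : Transfers G G₁ := transfers_of_collapse ι id Function.injective_id (fun _ => rfl)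
    (fun _ => rfl) (fun _ => le_rfl) fun e he => absurd ⟨e, rfl⟩ he
  let e₀ : E := Classical.arbitrary E
  -- The vertices `0` and `Fin.last k` may still be isolated, so `G₁` need not be connected; one
  -- only records that its edges lie in one component.
  have lev₁ : Levelled a G₁ (fun e t => G.dist x (G.param e t)) (ι (G.src e₀)) := by
    refine ⟨fun e => ?_, fun e => ?_, fun e s hs t ht => ?_, fun e => ?_⟩
    · simp only [param_zero]; exact (hι _).symm
    · simp only [G₁, param_len]; exact (hι _).symm
    · have h₁ := dist_le_add_of_hasPath hG (.refl (x := x)) (hasPath_param e hs ht)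
      have h₂ := dist_le_add_of_hasPath hG (.refl (x := x)) (hasPath_param e ht hs)
      rw [abs_sub_comm t s] at h₂
      rw [abs_le]
      constructor <;> linarith
    · refine ReflTransGen.lift ι ?_ _ _ (hG (G.src e₀) (G.src e))
      rintro v w ⟨e, ⟨rfl, rfl⟩ | ⟨rfl, rfl⟩⟩
      exacts [⟨e, .inl ⟨rfl, rfl⟩⟩, ⟨e, .inr ⟨rfl, rfl⟩⟩]
  -- cut at the two end points of the diameter
  obtain ⟨ex, sx, hsx, hx⟩ := exists_param_eq hG x
  obtain ⟨ey, sy, hsy, hy⟩ := exists_param_eq hG y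
  obtain ⟨E₂, _, G₂, g₂, lev₂, t₂, l₂, -, b₂, keep⟩ :=
    lev₁.exists_reach ha.injective (e₀ := ex) hsx (x := 0) (by simp only [hx, ha0, dist_self])
  -- The first cut may have moved `y` to another edge or parameter; what survives, and suffices, is
  -- that level `D` is attained.
  obtain ⟨e', s', hs', he'⟩ := keep D ⟨ey, sy, hsy, by simp only [hy, hxy]⟩
  obtain ⟨E₃, _, G₃, g₃, lev₃, t₃, l₃, r₃, b₃, -⟩ :=
    lev₂.exists_reach ha.injective hs' (x := Fin.last k) (by rw [he', haD])
  have reach₃ : ReflTransGen G₃.Adj 0 (Fin.last k) :=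
    (reflTransGen_symm (r₃ _ _ b₂)).trans b₃
  -- delete the loops, shorten the edges, and cut those that jump
  obtain ⟨E₄, _, G₄, len₄, t₄, l₄, r₄⟩ := exists_tight (G := G₃) ha.injective fun e => by
    have hl := (G₃.len_pos e).le
    have := lev₃.lip e 0 ⟨le_rfl, hl⟩ _ ⟨hl, le_rfl⟩
    rwa [lev₃.left, lev₃.right, zero_sub, abs_neg, abs_of_nonneg hl] at this
  obtain ⟨E₅, _, G₅, len₅, dist₅, t₅, l₅, r₅⟩ := exists_tight_adjacent ha _ G₄ len₄ rfl
  -- The walk from `0` to `Fin.last k` has survived every operation, and now crosses each gap.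
  have gap₅ : ∀ i : Fin k, G₅.Adj i.castSucc i.succ := fun i =>
    adj_of_reflTransGen dist₅ i (r₅ _ _ (r₄ _ _ reach₃)) (by simp)
  let ε := (Fintype.equivFin E₅).symm
  let H : MetricGraph (Fin (k + 1)) (Fin (Fintype.card E₅)) :=
    ⟨fun e => G₅.src (ε e), fun e => G₅.tgt (ε e), fun e => G₅.len (ε e),
      fun e => G₅.len_pos (ε e)⟩
  have t₆ : Transfers G₅ H := transfers_of_collapse id ε ε.injective (fun _ => rfl)
    (fun _ => rfl) (fun _ => le_rfl) fun e he => absurd (ε.surjective e) he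
  have lenH : ∀ e, H.len e = |a (H.src e) - a (H.tgt e)| := fun e => len₅ (ε e)
  have distH : ∀ e, Nat.dist (H.src e) (H.tgt e) = 1 := fun e => dist₅ (ε e)
  have gapH : ∀ i : Fin k, H.Adj i.castSucc i.succ := fun i => by
    obtain ⟨e, he⟩ := gap₅ i
    refine ⟨ε.symm e, ?_⟩
    simpa [H] using he
  have lH : H.totalLength = G₅.totalLength := ε.sum_comp fun e => G₅.len e
  have : Nonempty (Fin (Fintype.card E₅)) := ⟨(gapH ⟨0, hkpos⟩).choose⟩
  refine ⟨_, _, H, isPumpkinChain_of_chain hkpos lenH distH gapH, ?_, ?_, ?_,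
    (((((t₁.trans t₂).trans t₃).trans t₄).trans t₅).trans t₆).spectralGap_le⟩
  · rw [diam_of_chain ha lenH gapH, haD, ha0, sub_zero]
  · rw [lH, l₅]
    exact l₄.trans (l₃.trans l₂).le
  · rw [numVertices, numVertices, Fintype.card_fin, ← hk]
    exact hA

/-- Without edges no vertex has a neighbour, so there are no end vertices. This places pumpkin
chains among the graphs admitted in the larger supremum. -/
theorem IsPumpkinChain.pos {n m : ℕ} {G : MetricGraph (Fin n) (Fin m)} (h : G.IsPumpkinChain) :
    0 < m := by
  rcases Nat.eq_zero_or_pos m with rfl | hm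
  · obtain ⟨-, -, -, h, -⟩ := h
    have hempty : ∀ v, G.neighbors v = ∅ := fun v =>
      Set.eq_empty_of_forall_notMem fun w hw => hw.2.choose.elim0
    simp [hempty] at h
  · exact hm

end MetricGraph

theorem mainTheorem6 :
    (∀ (V E : Type*) [Fintype V] [Fintype E] [Nonempty E] (G : MetricGraph V E), G.Connected →
      ∃ (n m : ℕ) (H : MetricGraph (Fin n) (Fin m)), H.IsPumpkinChain ∧
        H.diam = G.diam ∧ H.totalLength ≤ G.totalLength ∧
        H.numVertices ≤ G.numVertices + 2 ∧
        G.spectralGap ≤ H.spectralGap) ∧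
    (∀ D : ℝ, 0 < D →
      sSup {r : EReal | ∃ (n m : ℕ) (G : MetricGraph (Fin n) (Fin m)), 0 < m ∧ G.Connected ∧
          G.diam = D ∧ r = (G.spectralGap : EReal)} =
      sSup {r : EReal | ∃ (n m : ℕ) (G : MetricGraph (Fin n) (Fin m)), G.IsPumpkinChain ∧
          G.diam = D ∧ r = (G.spectralGap : EReal)}) := by
  refine ⟨fun V E _ _ _ G hG => G.exists_pumpkinChain hG, fun D _ => le_antisymm ?_ ?_⟩
  · refine sSup_le ?_
    rintro _ ⟨n, m, G, hm, hG, hD, rfl⟩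
    have : Nonempty (Fin m) := ⟨⟨0, hm⟩⟩
    obtain ⟨n', m', H, hH, hHD, -, -, hgap⟩ := G.exists_pumpkinChain hG
    exact (EReal.coe_le_coe_iff.2 hgap).trans (le_sSup ⟨n', m', H, hH, hHD.trans hD, rfl⟩)
  · refine sSup_le_sSup ?_
    rintro _ ⟨n, m, G, hG, hD, rfl⟩
    exact ⟨n, m, G, hG.pos, hG.1, hD, rfl⟩
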